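/- Let $(M,g)$ be a connected smooth Riemannian $3$-manifold with Levi-Civita connection $\nabla$, Ricci tensor $S$ and scalar curvature $r$. Let $(\phi,\xi,\eta)$ be an almost contact metric structure on it: smooth tensor fields $\phi$ of type $(1,1)$, $\xi$ a vector field and $\eta$ a $1$-form, such that for all vector fields $X,Y$ $$\phi^2=-I+\eta\otimes\xi,\quad \eta(\xi)=1,\quad \eta(X)=g(X,\xi),\quad g(\phi X,\phi Y)=g(X,Y)-\eta(X)\eta(Y),\quad g(X,\phi Y)+g(Y,\phi X)=0 .$$ Suppose that it is trans-Sasakian of type $(\alpha,\beta)$ with real constants $\alpha,\beta$, not both zero, that is, $$(\nabla_X\phi)Y=\alpha\,[g(X,Y)\xi-\eta(Y)X]+\beta\,[g(\phi X,Y)\xi-\eta(Y)\phi X]\qquad\text{for all } X,Y .$$ Suppose that $(M,g)$ admits an $\eta$-Einstein soliton $(g,V,\lambda,\mu)$, that is, $V$ is a smooth vector field and $\lambda,\mu$ are real constants with $$\mathcal L_Vg+2S+(2\lambda-r)g+2\mu\,\eta\otimes\eta=0,$$ and that $V$ is pointwise collinear with $\xi$: $V=b\,\xi$ for a function $b:M\to\mathbb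 R$. Then $b$ is constant, and $M$ is $\eta$-Einstein (there are smooth functions $a,c$ on $M$ with $S=a\,g+c\,\eta\otimes\eta$) with constant scalar curvature $$r=2\lambda+2\mu+4(\alpha^2-\beta^2).$$ -/

import Mathlib

open Bundle VectorField
open scoped Manifold ContDiff Topology

noncomputable section

namespace RiemGeom

set_option linter.unusedSectionVars false

variable {E : Type*} [NormedAddCommGroup E] [NormedSpace ℝ E] [FiniteDimensional ℝ E]
  {H : Type*} [TopologicalSpace H] {I : ModelWithCorners ℝ E H}
  {M : Type*} [TopologicalSpace M] [ChartedSpace H M] [IsManifold I ∞ M]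
  [RiemannianBundle (fun x : M ↦ TangentSpace I x)]
  [IsContMDiffRiemannianBundle I ∞ E (fun x : M ↦ TangentSpace I x)]

/-- The function `g(X, Y)`. -/
def metricFun (X Y : Π x : M, TangentSpace I x) (x : M) : ℝ := inner ℝ (X x) (Y x)

/-- Right-hand side of the Koszul formula:
`X g(Y,Z) + Y g(Z,X) - Z g(X,Y) - g(X,[Y,Z]) + g(Y,[Z,X]) + g(Z,[X,Y])`. -/
def koszul (X Y Z : Π x : M, TangentSpace I x) (x : M) : ℝ :=
  d% (metricFun Y Z) x (X x) + d% (metricFun Z X) x (Y x) - d% (metricFun X Y) x (Z x)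
    - inner ℝ (X x) (mlieBracket I Y Z x) + inner ℝ (Y x) (mlieBracket I Z X x)
    + inner ℝ (Z x) (mlieBracket I X Y x)

variable {X X' Y Y' Z Z' : Π x : M, TangentSpace I x} {f : M → ℝ} {x : M}

theorem mdiff_metricFun (hX : MDiffAt (T% X) x)
    (hY : MDiffAt (T% Y) x) : MDiffAt (metricFun X Y) x :=
  MDifferentiableAt.inner_bundle (F := E) (E := fun x : M ↦ TangentSpace I x) hX hY

theorem metricFun_comm : metricFun X Y = metricFun Y X := by
  ext y; exact real_inner_comm _ _

theorem metricFun_smul_left : metricFun (f • X) Y = f * metricFun X Y := by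
  ext y; simp [metricFun, inner_smul_left]

theorem metricFun_smul_right : metricFun X (f • Y) = f * metricFun X Y := by
  ext y; simp [metricFun, inner_smul_right]

theorem metricFun_add_left : metricFun (X + X') Y = metricFun X Y + metricFun X' Y := by
  ext y; simp [metricFun, inner_add_left]

theorem metricFun_add_right : metricFun X (Y + Y') = metricFun X Y + metricFun X Y' := by
  ext y; simp [metricFun, inner_add_right]

theorem koszul_smul₁ (hX : MDiffAt (T% X) x) (hY : MDiffAt (T% Y) x) (hZ : MDiffAt (T% Z) x)
    (hf : MDiffAt f x) : koszul (f • X) Y Z x = f x * koszul X Y Z x := by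
  simp only [koszul, metricFun_smul_left, metricFun_smul_right, mlieBracket_smul_left hf hX,
    mlieBracket_smul_right hf hX, mvfderiv_mul hf (mdiff_metricFun hZ hX),
    mvfderiv_mul hf (mdiff_metricFun hX hY)]
  simp [inner_add_right, inner_smul_left, inner_smul_right, metricFun,
    real_inner_comm]
  ring

theorem koszul_smul₂ (hX : MDiffAt (T% X) x) (hY : MDiffAt (T% Y) x) (hZ : MDiffAt (T% Z) x)
    (hf : MDiffAt f x) :
    koszul X (f • Y) Z x = f x * koszul X Y Z x + 2 * (d% f x (X x) * inner ℝ (Y x) (Z x)) := by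
  simp only [koszul, metricFun_smul_left, metricFun_smul_right, mlieBracket_smul_left hf hY,
    mlieBracket_smul_right hf hY, mvfderiv_mul hf (mdiff_metricFun hX hY),
    mvfderiv_mul hf (mdiff_metricFun hY hZ)]
  simp [inner_add_right, inner_smul_left, inner_smul_right, metricFun,
    real_inner_comm]
  ring

theorem koszul_smul₃ (hX : MDiffAt (T% X) x) (hY : MDiffAt (T% Y) x) (hZ : MDiffAt (T% Z) x)
    (hf : MDiffAt f x) : koszul X Y (f • Z) x = f x * koszul X Y Z x := by
  simp only [koszul, metricFun_smul_left, metricFun_smul_right, mlieBracket_smul_left hf hZ,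
    mlieBracket_smul_right hf hZ, mvfderiv_mul hf (mdiff_metricFun hZ hX),
    mvfderiv_mul hf (mdiff_metricFun hY hZ)]
  simp [inner_add_right, inner_smul_left, inner_smul_right, metricFun,
    real_inner_comm]
  ring

theorem koszul_add₁ (hX : MDiffAt (T% X) x) (hX' : MDiffAt (T% X') x) (hY : MDiffAt (T% Y) x)
    (hZ : MDiffAt (T% Z) x) : koszul (X + X') Y Z x = koszul X Y Z x + koszul X' Y Z x := by
  simp only [koszul, metricFun_add_left, metricFun_add_right, mlieBracket_add_left hX hX',
    mlieBracket_add_right hX hX', mvfderiv_add (mdiff_metricFun hZ hX) (mdiff_metricFun hZ hX'),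
    mvfderiv_add (mdiff_metricFun hX hY) (mdiff_metricFun hX' hY)]
  simp [inner_add_left, inner_add_right]
  ring

theorem koszul_add₂ (hX : MDiffAt (T% X) x) (hY : MDiffAt (T% Y) x) (hY' : MDiffAt (T% Y') x)
    (hZ : MDiffAt (T% Z) x) : koszul X (Y + Y') Z x = koszul X Y Z x + koszul X Y' Z x := by
  simp only [koszul, metricFun_add_left, metricFun_add_right, mlieBracket_add_left hY hY',
    mlieBracket_add_right hY hY', mvfderiv_add (mdiff_metricFun hY hZ) (mdiff_metricFun hY' hZ),
    mvfderiv_add (mdiff_metricFun hX hY) (mdiff_metricFun hX hY')]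
  simp [inner_add_left, inner_add_right]
  ring

theorem koszul_add₃ (hX : MDiffAt (T% X) x) (hY : MDiffAt (T% Y) x) (hZ : MDiffAt (T% Z) x)
    (hZ' : MDiffAt (T% Z') x) : koszul X Y (Z + Z') x = koszul X Y Z x + koszul X Y Z' x := by
  simp only [koszul, metricFun_add_left, metricFun_add_right, mlieBracket_add_left hZ hZ',
    mlieBracket_add_right hZ hZ', mvfderiv_add (mdiff_metricFun hY hZ) (mdiff_metricFun hY hZ'),
    mvfderiv_add (mdiff_metricFun hZ hX) (mdiff_metricFun hZ' hX)]
  simp [inner_add_left, inner_add_right]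
  ring

/-- For fixed `Y`, differentiable at `x`, the expression `(X, Z) ↦ K(X, Y, Z)(x)` is tensorial in
`X` and `Z`; this is the resulting bilinear form on `T_x M`. -/
def koszulForm (Y : Π x : M, TangentSpace I x) (x : M) (hY : MDiffAt (T% Y) x) :
    TangentSpace I x →L[ℝ] TangentSpace I x →L[ℝ] ℝ :=
  TensorialAt.mkHom₂ (I := I) (F := E) (F' := E) (V := fun x : M ↦ TangentSpace I x)
    (V' := fun x : M ↦ TangentSpace I x) (fun X Z ↦ koszul X Y Z x) x
    (fun _ hZ ↦ ⟨fun hf hX ↦ koszul_smul₁ hX hY hZ hf, fun hX hX' ↦ koszul_add₁ hX hX' hY hZ⟩)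
    (fun _ hX ↦ ⟨fun hf hZ ↦ koszul_smul₃ hX hY hZ hf, fun hZ hZ' ↦ koszul_add₃ hX hY hZ hZ'⟩)

theorem koszulForm_apply (hX : MDiffAt (T% X) x) (hY : MDiffAt (T% Y) x) (hZ : MDiffAt (T% Z) x) :
    koszulForm Y x hY (X x) (Z x) = koszul X Y Z x :=
  TensorialAt.mkHom₂_apply (I := I) (F := E) (F' := E) (V := fun x : M ↦ TangentSpace I x)
    (V' := fun x : M ↦ TangentSpace I x) (Φ := fun X Z ↦ koszul X Y Z x) _ _ hX hZ

instance (x : M) : FiniteDimensional ℝ (TangentSpace I x) :=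
  VectorBundle.finiteDimensional ℝ E (fun x : M ↦ TangentSpace I x) x

variable (I M) in
/-- A chosen orthonormal basis of `T_x M`. -/
def frame (x : M) := stdOrthonormalBasis ℝ (TangentSpace I x)

open Classical in
/-- The covariant derivative `v ↦ ∇_v Y` at `x`, defined by the Koszul formula
`2 g(∇_v Y, w) = K(v, Y, w)`, that is `∇_v Y = ∑ i, (1/2) K(v, Y, e_i) e_i`
(and `0` where `Y` is not differentiable). -/
def leviCivitaFun (Y : Π x : M, TangentSpace I x) (x : M) :
    TangentSpace I x →L[ℝ] TangentSpace I x :=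
  if hY : MDiffAt (T% Y) x then
    ∑ i, ((1 / 2 : ℝ) • (koszulForm Y x hY).flip (frame I M x i)).smulRight (frame I M x i)
  else 0

theorem inner_leviCivitaFun (hX : MDiffAt (T% X) x) (hY : MDiffAt (T% Y) x)
    (hZ : MDiffAt (T% Z) x) :
    inner ℝ (leviCivitaFun Y x (X x)) (Z x) = 1 / 2 * koszul X Y Z x := by
  have h : ∑ i, inner ℝ (frame I M x i) (Z x) • frame I M x i = Z x :=
    (frame I M x).sum_repr' (Z x)
  rw [← koszulForm_apply hX hY hZ]
  conv_rhs => rw [← h]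
  simp only [leviCivitaFun, hY, dite_true, sum_inner, sum_apply,
    ContinuousLinearMap.smulRight_apply, inner_smul_left, map_sum, map_smul, Finset.mul_sum]
  refine Finset.sum_congr rfl fun i _ ↦ ?_
  simp
  ring

variable (I M) in
/-- The Levi-Civita connection of the Riemannian metric; `leviCivita I M Y x v` is `∇_v Y`. The two
theorems below show that it is torsion-free and metric. -/
def leviCivita : CovariantDerivative I E (fun x : M ↦ TangentSpace I x) where
  toFun := leviCivitaFun
  isCovariantDerivativeOnUniv :=
    { add := fun {Y Y' x} hY hY' _ ↦ by
        ext1 v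
        refine ext_inner_right ℝ fun w ↦ ?_
        have hv := FiberBundle.mdifferentiableAt_extend I E (V := fun x : M ↦ TangentSpace I x) v
        have hw := FiberBundle.mdifferentiableAt_extend I E (V := fun x : M ↦ TangentSpace I x) w
        have h := inner_leviCivitaFun hv (mdifferentiableAt_add_section hY hY') hw
        have h1 := inner_leviCivitaFun hv hY hw
        have h2 := inner_leviCivitaFun hv hY' hw
        rw [koszul_add₂ hv hY hY' hw, mul_add, ← h1, ← h2, ← inner_add_left] at h
        simpa using h
      leibniz := fun {Y g x} hY hg _ ↦ by
        ext1 v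
        refine ext_inner_right ℝ fun w ↦ ?_
        have hv := FiberBundle.mdifferentiableAt_extend I E (V := fun x : M ↦ TangentSpace I x) v
        have hw := FiberBundle.mdifferentiableAt_extend I E (V := fun x : M ↦ TangentSpace I x) w
        have h := inner_leviCivitaFun hv (hg.smul_section hY) hw
        have h1 := inner_leviCivitaFun hv hY hw
        rw [koszul_smul₂ hv hY hw hg] at h
        simp only [FiberBundle.extend_apply_self] at h h1
        refine h.trans ?_
        simp [inner_add_left, inner_smul_left, h1]
        ring }

theorem leviCivita_torsion : (leviCivita I M).torsion = 0 := by
  rw [CovariantDerivative.torsion_eq_zero_iff]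
  intro X Y x hX hY
  refine ext_inner_right ℝ fun w ↦ ?_
  have hw := FiberBundle.mdifferentiableAt_extend I E (V := fun x : M ↦ TangentSpace I x) w
  have h1 := inner_leviCivitaFun hX hY hw
  have h2 := inner_leviCivitaFun hY hX hw
  simp only [FiberBundle.extend_apply_self] at h1 h2
  rw [inner_sub_left]
  refine (congrArg₂ (· - ·) h1 h2).trans ?_
  simp only [koszul]
  rw [metricFun_comm (X := Y) (Y := X), mlieBracket_swap_apply (V := Y) (W := X),
    metricFun_comm (X := Y), metricFun_comm (X := X) (Y := FiberBundle.extend E w),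
    mlieBracket_swap_apply (V := Y) (W := FiberBundle.extend E w),
    mlieBracket_swap_apply (V := X) (W := FiberBundle.extend E w)]
  simp [real_inner_comm]
  ring

theorem leviCivita_metric (hX : MDiffAt (T% X) x) (hY : MDiffAt (T% Y) x)
    (hZ : MDiffAt (T% Z) x) :
    d% (metricFun Y Z) x (X x) =
      inner ℝ (leviCivita I M Y x (X x)) (Z x) + inner ℝ (Y x) (leviCivita I M Z x (X x)) := by
  rw [real_inner_comm (leviCivita I M Z x (X x)) (Y x)]
  refine Eq.trans ?_ (congrArg₂ (· + ·) (inner_leviCivitaFun hX hY hZ)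
    (inner_leviCivitaFun hX hZ hY)).symm
  simp only [koszul]
  rw [metricFun_comm (X := Z) (Y := Y), mlieBracket_swap_apply (V := Z) (W := Y),
    metricFun_comm (X := Y) (Y := X), metricFun_comm (X := X) (Y := Z),
    mlieBracket_swap_apply (V := Y) (W := X),
    mlieBracket_swap_apply (V := X) (W := Z)]
  simp
  ring

/-- The curvature `R(X,Y)Z = ∇_X ∇_Y Z - ∇_Y ∇_X Z - ∇_[X,Y] Z`. -/
def curvature (X Y Z : Π x : M, TangentSpace I x) (x : M) : TangentSpace I x :=
  leviCivita I M (fun y ↦ leviCivita I M Z y (Y y)) x (X x)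
    - leviCivita I M (fun y ↦ leviCivita I M Z y (X y)) x (Y x)
    - leviCivita I M Z x (mlieBracket I X Y x)

/-- The Ricci tensor `S(v, w)`, the trace of `u ↦ R(u, v) w` on `T_x M`. The curvature is a tensor,
so it is evaluated on tangent vectors by extending them to vector fields that are smooth near
`x`. -/
def ricci (x : M) (v w : TangentSpace I x) : ℝ :=
  ∑ i, inner ℝ (curvature (I := I) (FiberBundle.extend E (frame I M x i)) (FiberBundle.extend E v)
    (FiberBundle.extend E w) x) (frame I M x i)

variable (I M) in
/-- The scalar curvature `r`, the metric trace of the Ricci tensor. -/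
def scalarCurvature (x : M) : ℝ := ∑ i, ricci x (frame I M x i) (frame I M x i)

/-- The Lie derivative of the metric:
`(L_V g)(X, Y) = V g(X, Y) - g([V, X], Y) - g(X, [V, Y])`. -/
def lieDerivMetric (V X Y : Π x : M, TangentSpace I x) (x : M) : ℝ :=
  d% (metricFun X Y) x (V x) - inner ℝ (mlieBracket I V X x) (Y x)
    - inner ℝ (X x) (mlieBracket I V Y x)

/-- `(φ, ξ, η)` is an almost contact metric structure on the Riemannian manifold `M`. -/
structure IsAlmostContactMetric (φ : Π x : M, TangentSpace I x →L[ℝ] TangentSpace I x)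
    (ξ : Π x : M, TangentSpace I x) (η : Π x : M, TangentSpace I x →L[ℝ] ℝ) : Prop where
  smooth_phi : ContMDiff I (I.prod 𝓘(ℝ, E →L[ℝ] E)) ∞
    (fun x ↦ TotalSpace.mk' (E →L[ℝ] E)
      (E := fun x : M ↦ TangentSpace I x →L[ℝ] TangentSpace I x) x (φ x))
  smooth_xi : CMDiff ∞ (T% ξ)
  smooth_eta : ContMDiff I (I.prod 𝓘(ℝ, E →L[ℝ] ℝ)) ∞
    (fun x ↦ TotalSpace.mk' (E →L[ℝ] ℝ)
      (E := fun x : M ↦ TangentSpace I x →L[ℝ] Trivial M ℝ x) x (η x))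
  phi_sq : ∀ (x : M) (v : TangentSpace I x), φ x (φ x v) = -v + η x v • ξ x
  eta_xi : ∀ x : M, η x (ξ x) = 1
  eta_eq : ∀ (x : M) (v : TangentSpace I x), η x v = inner ℝ v (ξ x)
  inner_phi_phi : ∀ (x : M) (v w : TangentSpace I x),
    inner ℝ (φ x v) (φ x w) = inner ℝ v w - η x v * η x w
  inner_phi : ∀ (x : M) (v w : TangentSpace I x), inner ℝ v (φ x w) + inner ℝ w (φ x v) = 0

/-- The covariant derivative `(∇_v φ) Y = ∇_v (φ Y) - φ (∇_v Y)` of a field of endomorphisms. -/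
def covDerivEnd (φ : Π x : M, TangentSpace I x →L[ℝ] TangentSpace I x)
    (Y : Π x : M, TangentSpace I x) (x : M) (v : TangentSpace I x) : TangentSpace I x :=
  leviCivita I M (fun y ↦ φ y (Y y)) x v - φ x (leviCivita I M Y x v)

/-- `(φ, ξ, η)` is a trans-Sasakian structure of type `(α, β)` on the Riemannian manifold `M`. -/
structure IsTransSasakian (φ : Π x : M, TangentSpace I x →L[ℝ] TangentSpace I x)
    (ξ : Π x : M, TangentSpace I x) (η : Π x : M, TangentSpace I x →L[ℝ] ℝ)
    (α β : M → ℝ) : Prop extends IsAlmostContactMetric φ ξ η where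
  smooth_alpha : CMDiff ∞ α
  smooth_beta : CMDiff ∞ β
  cov_phi : ∀ (x : M) (v : TangentSpace I x) (Y : Π x : M, TangentSpace I x), MDiffAt (T% Y) x →
    covDerivEnd φ Y x v =
      α x • ((inner ℝ v (Y x) : ℝ) • ξ x - η x (Y x) • v)
        + β x • ((inner ℝ (φ x v) (Y x) : ℝ) • ξ x - η x (Y x) • φ x v)

/-- `(g, V, lam, mu)` is an η-Einstein soliton:
`L_V g + 2 S + (2 lam - r) g + 2 mu η ⊗ η = 0`. -/
structure IsEtaEinsteinSoliton (η : Π x : M, TangentSpace I x →L[ℝ] ℝ)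
    (V : Π x : M, TangentSpace I x) (lam mu : ℝ) : Prop where
  smooth : CMDiff ∞ (T% V)
  eq_zero : ∀ (x : M) (X Y : Π x : M, TangentSpace I x), MDiffAt (T% X) x → MDiffAt (T% Y) x →
    lieDerivMetric V X Y x + 2 * ricci x (X x) (Y x)
      + (2 * lam - scalarCurvature I M x) * inner ℝ (X x) (Y x)
      + 2 * mu * (η x (X x) * η x (Y x)) = 0

/-- `M` is η-Einstein: `S = a g + c η ⊗ η` for some smooth functions `a`, `c`. -/
def IsEtaEinstein (η : Π x : M, TangentSpace I x →L[ℝ] ℝ) : Prop :=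
  ∃ a c : M → ℝ, CMDiff ∞ a ∧ CMDiff ∞ c ∧ ∀ (x : M) (v w : TangentSpace I x),
    ricci x v w = a x * inner ℝ v w + c x * (η x v * η x w)

end RiemGeom

end

noncomputable section

namespace RiemGeom

/-! ### Brackets of vector fields as commutators of derivations. -/

section DirectionalDerivative

variable {E : Type*} [NormedAddCommGroup E] [NormedSpace ℝ E]
  {H : Type*} [TopologicalSpace H] {I : ModelWithCorners ℝ E H}
  {M : Type*} [TopologicalSpace M] [ChartedSpace H M]
  {X Y : Π x : M, TangentSpace I x} {f : M → ℝ} {x : M}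

/-! Evaluating `∇φ` on `ξ` gives `∇_X ξ = -α φX + β (X - η(X) ξ)` (`leviCivita_xi`). Differentiating
again gives `R(X,Y)ξ`, and a trace gives `S(X,ξ) = 2(α² - β²) η(X)` (`ricci_xi`). With `V = b ξ` the
soliton equation becomes algebraic in `S`, `g`, `η` and `db` (`ricci_eq`). Three contractions of it
suffice. On `(ξ,ξ)` it expresses `r` through `db(ξ)`; on `(v,ξ)` it then yields `db = db(ξ) η`; its
full trace, compared with the first, yields `b β = α² - β² - λ`. If `β ≠ 0`, the last identity makes
`b` constant. If `α ≠ 0`, `η` is a contact form, and `d(db) = 0` evaluated on `ker η` forces `db(ξ)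
= 0` (`mvfderiv_xi_eq_zero`), so `db = 0` and `b` is constant by connectedness. With `db = 0`, the
first contraction gives `r`, and the soliton equation solves for `S` with constant coefficients. -/

theorem mvfderiv_congr {f g : M → ℝ} {x : M} (h : f =ᶠ[𝓝 x] g) : d% f x = d% g x := by
  ext v
  simp only [mvfderiv, h.mfderiv_eq]
  rfl

theorem eventually_mdifferentiableAt [IsManifold I ∞ M] (hf : CMDiffAt ∞ f x) :
    ∀ᶠ y in 𝓝 x, MDiffAt f y := by
  have : IsManifold I 1 M := IsManifold.of_le (n := ∞) (by simp)
  have h : CMDiffAt 1 f x := hf.of_le (by simp)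
  filter_upwards [(contMDiffAt_iff_contMDiffAt_nhds (by simp)).1 h] with y hy
  exact hy.mdifferentiableAt one_ne_zero

theorem eventually_mdifferentiableAt_section [IsManifold I ∞ M] (hX : CMDiffAt ∞ (T% X) x) :
    ∀ᶠ y in 𝓝 x, MDiffAt (T% X) y := by
  have : IsManifold I 1 M := IsManifold.of_le (n := ∞) (by simp)
  have : IsManifold I 2 M := IsManifold.of_le (n := ∞) ENat.LEInfty.out
  have h : CMDiffAt 1 (T% X) x := hX.of_le (by simp)
  filter_upwards [(contMDiffAt_iff_contMDiffAt_nhds (by simp)).1 h] with y hy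
  exact hy.mdifferentiableAt one_ne_zero

/-- The derivative of a smooth function along a smooth vector field is smooth. -/
theorem contMDiffAt_mvfderiv_apply [IsManifold I ∞ M] (hf : CMDiffAt ∞ f x)
    (hX : CMDiffAt ∞ (T% X) x) : CMDiffAt ∞ (fun y ↦ d% f y (X y)) x := by
  have h1 := hf.mfderiv_const (m := ∞) (by simp)
  have h2 := ContMDiffAt.clm_apply_of_inCoordinates (F₁ := E) (F₂ := ℝ)
    (E₁ := fun x : M ↦ TangentSpace I x)
    (E₂ := fun x : ℝ ↦ TangentSpace 𝓘(ℝ, ℝ) x) (b₁ := id) (b₂ := f) (ϕ := mfderiv% f) (v := X)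
    h1 hX hf
  exact (contMDiff_snd_tangentBundle_modelSpace ℝ 𝓘(ℝ, ℝ)).contMDiffAt.comp x h2

/-- Chain rule: the pullback applies the inverse of the derivative of the inverse chart, which
cancels the factor coming from the composition. -/
theorem mvfderiv_apply_eq_fderivWithin [IsManifold I 1 M] {z : E}
    (hz : z ∈ (extChartAt I x).target) (hf : MDiffAt f ((extChartAt I x).symm z)) :
    fderivWithin ℝ (f ∘ (extChartAt I x).symm) (Set.range I) z
      (mpullbackWithin 𝓘(ℝ, E) I (extChartAt I x).symm Y (Set.range I) z) =
    d% f ((extChartAt I x).symm z) (Y ((extChartAt I x).symm z)) := by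
  have hu : UniqueMDiffAt[Set.range I] z :=
    I.uniqueMDiffOn z (extChartAt_target_subset_range x hz)
  rw [← mfderivWithin_eq_fderivWithin,
    mfderiv_comp_mfderivWithin z hf (mdifferentiableWithinAt_extChartAt_symm hz) hu]
  have h := (isInvertible_mfderivWithin_extChartAt_symm hz).self_apply_inverse
    (Y ((extChartAt I x).symm z))
  exact congrArg (mfderiv% f ((extChartAt I x).symm z)) h

/-- A vector field bracket acts on functions as the commutator of derivations. -/
theorem mvfderiv_mlieBracket [CompleteSpace E] [IsManifold I ∞ M] (hf : CMDiffAt ∞ f x)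
    (hX : CMDiffAt ∞ (T% X) x) (hY : CMDiffAt ∞ (T% Y) x) :
    d% f x (mlieBracket I X Y x) =
      d% (fun y ↦ d% f y (Y y)) x (X x) - d% (fun y ↦ d% f y (X y)) x (Y x) := by
  have hXf := (contMDiffAt_mvfderiv_apply hf hX).mdifferentiableAt (by simp)
  have hYf := (contMDiffAt_mvfderiv_apply hf hY).mdifferentiableAt (by simp)
  have hx := mem_extChartAt_target (I := I) x
  have hxr := extChartAt_target_subset_range x hx
  have hsymm : (extChartAt I x).symm (extChartAt I x x) = x := extChartAt_to_inv x
  -- The chart expressions of `df(X)` and `df(Y)` get differentiated once more, so they must be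
  -- identified near the base point and not only at it.
  have hev : ∀ᶠ z in 𝓝[Set.range I] (extChartAt I x x),
      z ∈ (extChartAt I x).target ∧ MDiffAt f ((extChartAt I x).symm z) := by
    have h1 := eventually_mdifferentiableAt hf
    have h2 := (continuousAt_extChartAt_symm (I := I) x).tendsto
    rw [hsymm] at h2
    filter_upwards [extChartAt_target_mem_nhdsWithin (I := I) x,
      (h2.eventually h1).filter_mono nhdsWithin_le_nhds] with z hz hz' using ⟨hz, hz'⟩
  have hcomm := fderivWithin_apply_lieBracket (𝕜 := ℝ) (n := ∞)
    (f := f ∘ (extChartAt I x).symm) (s := Set.range I) (x := extChartAt I x x)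
    (V := mpullbackWithin 𝓘(ℝ, E) I (extChartAt I x).symm X (Set.range I))
    (W := mpullbackWithin 𝓘(ℝ, E) I (extChartAt I x).symm Y (Set.range I))
    ?_ (by simpa using ENat.LEInfty.out) I.uniqueDiffOn
    (I.range_subset_closure_interior hxr) hxr ?_ ?_
  · have key : ∀ Z : Π x : M, TangentSpace I x,
        (fun z ↦ fderivWithin ℝ (f ∘ (extChartAt I x).symm) (Set.range I) z
          (mpullbackWithin 𝓘(ℝ, E) I (extChartAt I x).symm Z (Set.range I) z))
        =ᶠ[𝓝[Set.range I] (extChartAt I x x)]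
        (fun y ↦ d% f y (Z y)) ∘ (extChartAt I x).symm := fun Z ↦ by
      filter_upwards [hev] with z hz
      exact mvfderiv_apply_eq_fderivWithin hz.1 hz.2
    rw [(key X).fderivWithin_eq_of_mem hxr, (key Y).fderivWithin_eq_of_mem hxr,
      mvfderiv_apply_eq_fderivWithin (f := fun y ↦ d% f y (X y)) hx (by rwa [hsymm]),
      mvfderiv_apply_eq_fderivWithin (f := fun y ↦ d% f y (Y y)) hx (by rwa [hsymm])] at hcomm
    rw [hsymm] at hcomm
    rw [← hcomm, mlieBracket, mlieBracketWithin_apply, Set.preimage_univ, Set.univ_inter,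
      (hf.mdifferentiableAt (by simp)).mvfderiv]
    refine congrArg (fderivWithin ℝ (f ∘ (extChartAt I x).symm) (Set.range I) (extChartAt I x x)) ?_
    -- At its own base point the chart has identity derivative, so pulling the bracket back from the
    -- chart does not change its value.
    have h : (mfderiv% (extChartAt I x) x : E →L[ℝ] E) = ContinuousLinearMap.id ℝ E :=
      mfderiv_extChartAt_self
    exact (congrArg (fun A : E →L[ℝ] E ↦ A.inverse _) h).trans
      (by rw [ContinuousLinearMap.inverse_id, ContinuousLinearMap.id_apply])
  · refine ContMDiffWithinAt.contDiffWithinAt ?_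
    refine ContMDiffAt.comp_contMDiffWithinAt _ (by rwa [hsymm]) ?_
    exact contMDiffWithinAt_extChartAt_symm_range_self x
  · have h := ((hY.mdifferentiableAt (by simp)).mdifferentiableWithinAt
      (s := Set.univ)).differentiableWithinAt_mpullbackWithin_vectorField
    rwa [Set.preimage_univ, Set.univ_inter] at h
  · have h := ((hX.mdifferentiableAt (by simp)).mdifferentiableWithinAt
      (s := Set.univ)).differentiableWithinAt_mpullbackWithin_vectorField
    rwa [Set.preimage_univ, Set.univ_inter] at h

end DirectionalDerivative

/-! ### Differentiability of `∇_X Y` and skew-symmetry of the curvature. -/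

section Smoothness

set_option linter.unusedSectionVars false

variable {E : Type*} [NormedAddCommGroup E] [NormedSpace ℝ E] [FiniteDimensional ℝ E]
  {H : Type*} [TopologicalSpace H] {I : ModelWithCorners ℝ E H}
  {M : Type*} [TopologicalSpace M] [ChartedSpace H M] [IsManifold I ∞ M]
  [RiemannianBundle (fun x : M ↦ TangentSpace I x)]
  [IsContMDiffRiemannianBundle I ∞ E (fun x : M ↦ TangentSpace I x)]
  {X Y Z W : Π x : M, TangentSpace I x} {f : M → ℝ} {x : M}

theorem contMDiffAt_metricFun (hX : CMDiffAt ∞ (T% X) x) (hY : CMDiffAt ∞ (T% Y) x) :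
    CMDiffAt ∞ (metricFun X Y) x :=
  ContMDiffAt.inner_bundle (F := E) (E := fun x : M ↦ TangentSpace I x) hX hY

theorem contMDiffAt_mlieBracket (hX : CMDiffAt ∞ (T% X) x) (hY : CMDiffAt ∞ (T% Y) x) :
    CMDiffAt ∞ (T% (mlieBracket I X Y)) x := by
  have : IsManifold I (((⊤ : ℕ∞) : WithTop ℕ∞) + 1) M := by simpa using ‹IsManifold I ∞ M›
  have : IsManifold I (minSmoothness ℝ 3) M := by
    simpa using IsManifold.of_le (n := ∞) (m := 3) ENat.LEInfty.out
  exact ContMDiffAt.mlieBracket_vectorField (m := ⊤) (n := ⊤) hX hY (by simp)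

theorem contMDiffAt_koszul (hX : CMDiffAt ∞ (T% X) x) (hY : CMDiffAt ∞ (T% Y) x)
    (hZ : CMDiffAt ∞ (T% Z) x) : CMDiffAt ∞ (koszul X Y Z) x := by
  have h1 := contMDiffAt_mvfderiv_apply (contMDiffAt_metricFun hY hZ) hX
  have h2 := contMDiffAt_mvfderiv_apply (contMDiffAt_metricFun hZ hX) hY
  have h3 := contMDiffAt_mvfderiv_apply (contMDiffAt_metricFun hX hY) hZ
  have h4 := contMDiffAt_metricFun hX (contMDiffAt_mlieBracket hY hZ)
  have h5 := contMDiffAt_metricFun hY (contMDiffAt_mlieBracket hZ hX)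
  have h6 := contMDiffAt_metricFun hZ (contMDiffAt_mlieBracket hX hY)
  exact ((((h1.add h2).sub h3).sub h4).add h5).add h6

/-- By Cramer's rule, a vector field is differentiable if its inner products with smooth vector
fields are. -/
theorem mdifferentiableAt_of_metricFun
    (h : ∀ Z : Π x : M, TangentSpace I x, CMDiffAt ∞ (T% Z) x → MDiffAt (metricFun W Z) x) :
    MDiffAt (T% W) x := by
  set e := trivializationAt E (fun x : M ↦ TangentSpace I x) x
  have hx : x ∈ e.baseSet := FiberBundle.mem_baseSet_trivializationAt' x
  let b := Module.finBasis ℝ E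
  have : IsManifold I 1 M := IsManifold.of_le (n := ∞) (by simp)
  have : IsManifold I (∞ + 1) M := by simpa using ‹IsManifold I ∞ M›
  let s := e.localFrame b
  have hs : IsLocalFrameOn I E ∞ s e.baseSet := e.isLocalFrameOn_localFrame_baseSet I ∞ b
  have hsx : ∀ i, CMDiffAt ∞ (T% (s i)) x := hs.contMDiffAt e.open_baseSet hx
  let G : M → Matrix (Fin (Module.finrank ℝ E)) (Fin (Module.finrank ℝ E)) ℝ :=
    fun y ↦ Matrix.gram ℝ fun i ↦ s i y
  let c : M → Fin (Module.finrank ℝ E) → ℝ := fun y i ↦ metricFun W (s i) y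
  have hdet : ∀ y ∈ e.baseSet, (G y).det ≠ 0 := fun y hy ↦
    (Matrix.posDef_gram_of_linearIndependent (hs.linearIndependent hy)).det_pos.ne'
  have hcramer : ∀ y ∈ e.baseSet, ∀ i,
      hs.coeff i y (W y) = ((G y).det)⁻¹ * (G y).cramer (c y) i := fun y hy i ↦ by
    -- Pairing `W` with the frame multiplies its coefficient vector by the Gram matrix, which is
    -- invertible because the frame is linearly independent.
    have hc : c y = (G y).mulVec fun j ↦ hs.coeff j y (W y) := by
      ext i
      conv_lhs => simp only [c, metricFun]
      conv_lhs => rw [hs.coeff_sum_eq W hy]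
      simp [sum_inner, inner_smul_left, Matrix.mulVec, dotProduct, G, real_inner_comm, mul_comm]
    rw [hc, Matrix.cramer_eq_adjugate_mulVec, Matrix.mulVec_mulVec, Matrix.adjugate_mul]
    simp [Matrix.smul_mulVec, hdet y hy]
  have hdiff : ∀ A : M → Matrix (Fin (Module.finrank ℝ E)) (Fin (Module.finrank ℝ E)) ℝ,
      (∀ i j, MDiffAt (fun y ↦ A y i j) x) → MDiffAt (fun y ↦ (A y).det) x := fun A hA ↦ by
    have h : (fun y ↦ (A y).det) = ∑ σ : Equiv.Perm (Fin (Module.finrank ℝ E)),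
        fun y ↦ (Equiv.Perm.sign σ : ℝ) * ∏ i, A y (σ i) i := by
      ext y
      simp [Matrix.det_apply']
    rw [h]
    refine MDifferentiableAt.sum fun σ _ ↦ mdifferentiableAt_const.mul ?_
    have h : (fun y ↦ ∏ i, A y (σ i) i) = ∏ i, fun y ↦ A y (σ i) i := by
      ext y
      simp
    rw [h]
    exact MDifferentiableAt.prod fun i _ ↦ hA _ _
  have : IsLocalFrameOn I E 1 s e.baseSet := e.isLocalFrameOn_localFrame_baseSet I 1 b
  refine this.mdifferentiableAt_of_coeff (fun i ↦ ?_) (e.open_baseSet.mem_nhds hx)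
  have hG : ∀ i j, MDiffAt (fun y ↦ G y i j) x := fun i j ↦
    (contMDiffAt_metricFun (hsx i) (hsx j)).mdifferentiableAt (by simp)
  have hnum : MDiffAt (fun y ↦ (G y).cramer (c y) i) x := by
    simp only [Matrix.cramer_apply]
    refine hdiff _ fun j k ↦ ?_
    simp only [Matrix.updateCol_apply]
    split_ifs
    · exact h _ (hsx j)
    · exact hG j k
  have hinv : MDiffAt (fun y ↦ ((G y).det)⁻¹) x :=
    (differentiableAt_inv (hdet x hx)).mdifferentiableAt.comp x (hdiff G hG)
  refine (hinv.mul hnum).congr_of_eventuallyEq ?_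
  filter_upwards [e.open_baseSet.mem_nhds hx] with y hy
  exact hcramer y hy i

/-- The orthonormal bases in the definition of `leviCivitaFun` are chosen point by point, so
regularity cannot be read off from it. The Koszul formula instead shows that `g(∇_X Y, Z)` is smooth
for every smooth `Z`. This legitimises the second covariant derivatives in the curvature. -/
theorem mdifferentiableAt_leviCivita (hX : CMDiffAt ∞ (T% X) x) (hY : CMDiffAt ∞ (T% Y) x) :
    MDiffAt (T% (fun y ↦ leviCivita I M Y y (X y))) x := by
  refine mdifferentiableAt_of_metricFun fun Z hZ ↦ ?_
  refine ((contMDiffAt_const (c := (1 / 2 : ℝ))).mul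
    (contMDiffAt_koszul hX hY hZ)).mdifferentiableAt (by simp) |>.congr_of_eventuallyEq ?_
  filter_upwards [eventually_mdifferentiableAt_section hX, eventually_mdifferentiableAt_section hY,
    eventually_mdifferentiableAt_section hZ] with y h1 h2 h3
  exact inner_leviCivitaFun h1 h2 h3

/-- The curvature `R(X, Y)` is a skew-symmetric endomorphism. -/
theorem inner_curvature_swap [T2Space M] (hX : CMDiffAt ∞ (T% X) x) (hY : CMDiffAt ∞ (T% Y) x)
    (hZ : CMDiffAt ∞ (T% Z) x) (hW : CMDiffAt ∞ (T% W) x) :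
    inner ℝ (curvature X Y Z x) (W x) = - inner ℝ (curvature X Y W x) (Z x) := by
  have md : ∀ {U : Π x : M, TangentSpace I x}, CMDiffAt ∞ (T% U) x → MDiffAt (T% U) x :=
    fun h ↦ h.mdifferentiableAt (by simp)
  -- Metric compatibility is used twice. The two mixed terms are exchanged by swapping `U` and `V`,
  -- so they drop out of the commutator.
  have second : ∀ {U V : Π x : M, TangentSpace I x}, CMDiffAt ∞ (T% U) x → CMDiffAt ∞ (T% V) x →
      d% (fun y ↦ d% (metricFun Z W) y (V y)) x (U x) =
        inner ℝ (leviCivita I M (fun y ↦ leviCivita I M Z y (V y)) x (U x)) (W x)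
        + inner ℝ (leviCivita I M Z x (V x)) (leviCivita I M W x (U x))
        + (inner ℝ (leviCivita I M Z x (U x)) (leviCivita I M W x (V x))
        + inner ℝ (Z x) (leviCivita I M (fun y ↦ leviCivita I M W y (V y)) x (U x))) :=
    fun {U V} hU hV ↦ by
    have hZV := mdifferentiableAt_leviCivita hV hZ
    have hWV := mdifferentiableAt_leviCivita hV hW
    have hev : (fun y ↦ d% (metricFun Z W) y (V y)) =ᶠ[𝓝 x]
        metricFun (fun y ↦ leviCivita I M Z y (V y)) W
          + metricFun Z (fun y ↦ leviCivita I M W y (V y)) := by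
      filter_upwards [eventually_mdifferentiableAt_section hV,
        eventually_mdifferentiableAt_section hZ,
        eventually_mdifferentiableAt_section hW] with y h1 h2 h3
      exact leviCivita_metric h1 h2 h3
    rw [mvfderiv_congr hev, mvfderiv_add (mdiff_metricFun hZV (md hW))
      (mdiff_metricFun (md hZ) hWV), add_apply, leviCivita_metric (md hU) hZV (md hW),
      leviCivita_metric (md hU) (md hZ) hWV]
  have h1 := mvfderiv_mlieBracket (contMDiffAt_metricFun hZ hW) hX hY
  rw [second hX hY, second hY hX, leviCivita_metric (md (contMDiffAt_mlieBracket hX hY)) (md hZ)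
    (md hW)] at h1
  simp only [curvature, inner_sub_left]
  rw [real_inner_comm (Z x), real_inner_comm (Z x), real_inner_comm (Z x)]
  linarith

end Smoothness

/-! ### Curvature of a trans-Sasakian structure in the direction of `ξ`. -/

section TransSasakian

set_option linter.unusedSectionVars false

variable {E : Type*} [NormedAddCommGroup E] [NormedSpace ℝ E] [FiniteDimensional ℝ E]
  {H : Type*} [TopologicalSpace H] {I : ModelWithCorners ℝ E H}
  {M : Type*} [TopologicalSpace M] [ChartedSpace H M] [IsManifold I ∞ M]
  [RiemannianBundle (fun x : M ↦ TangentSpace I x)]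
  [IsContMDiffRiemannianBundle I ∞ E (fun x : M ↦ TangentSpace I x)]
  {φ : Π x : M, TangentSpace I x →L[ℝ] TangentSpace I x}
  {ξ : Π x : M, TangentSpace I x} {η : Π x : M, TangentSpace I x →L[ℝ] ℝ}
  {X Y Z W : Π x : M, TangentSpace I x} {f : M → ℝ} {x : M}

theorem contMDiffAt_extend (v : TangentSpace I x) :
    CMDiffAt ∞ (T% (FiberBundle.extend E v)) x :=
  FiberBundle.contMDiffAt_extend I E (V := fun x : M ↦ TangentSpace I x) v

theorem mdifferentiableAt_extend (v : TangentSpace I x) :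
    MDiffAt (T% (FiberBundle.extend E v)) x :=
  (contMDiffAt_extend v).mdifferentiableAt (by simp)

theorem mvfderiv_metricFun_apply (hY : MDiffAt (T% Y) x) (hZ : MDiffAt (T% Z) x)
    (v : TangentSpace I x) :
    d% (metricFun Y Z) x v =
      inner ℝ (leviCivita I M Y x v) (Z x) + inner ℝ (Y x) (leviCivita I M Z x v) := by
  have h := leviCivita_metric (mdifferentiableAt_extend v) hY hZ
  rwa [FiberBundle.extend_apply_self] at h

theorem mlieBracket_eq_leviCivita_sub (hX : MDiffAt (T% X) x) (hY : MDiffAt (T% Y) x) :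
    mlieBracket I X Y x = leviCivita I M Y x (X x) - leviCivita I M X x (Y x) :=
  ((CovariantDerivative.torsion_eq_zero_iff _).1 leviCivita_torsion hX hY).symm

theorem sum_inner_frame_mul (v w : TangentSpace I x) :
    ∑ i, inner ℝ v (frame I M x i) * inner ℝ w (frame I M x i) = inner ℝ v w := by
  rw [← (frame I M x).sum_inner_mul_inner v w]
  simp only [real_inner_comm]

theorem sum_inner_frame_self {n : ℕ} (hdim : Module.finrank ℝ E = n) (x : M) :
    ∑ i, inner ℝ (frame I M x i) (frame I M x i) = (n : ℝ) := by
  simp only [real_inner_self_eq_norm_sq, (frame I M x).norm_eq_one, one_pow, Finset.sum_const,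
    Finset.card_univ, Fintype.card_fin, nsmul_eq_mul, mul_one]
  exact_mod_cast hdim

namespace IsAlmostContactMetric

variable (h : IsAlmostContactMetric φ ξ η)
include h

theorem inner_xi_xi (x : M) : inner ℝ (ξ x) (ξ x) = (1 : ℝ) := by
  rw [← h.eta_eq, h.eta_xi]

theorem phi_xi (x : M) : φ x (ξ x) = 0 := by
  have h1 := h.inner_phi_phi x (ξ x) (ξ x)
  rw [h.inner_xi_xi, h.eta_xi, mul_one, sub_self] at h1
  exact inner_self_eq_zero.1 h1

theorem inner_phi_left (x : M) (v w : TangentSpace I x) :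
    inner ℝ (φ x v) w = - inner ℝ (φ x w) v := by
  rw [real_inner_comm, real_inner_comm v]
  exact eq_neg_of_add_eq_zero_left (h.inner_phi x w v)

theorem inner_phi_self (x : M) (v : TangentSpace I x) : inner ℝ (φ x v) v = (0 : ℝ) := by
  linarith [h.inner_phi_left x v v]

theorem inner_phi_xi (x : M) (v : TangentSpace I x) : inner ℝ (φ x v) (ξ x) = (0 : ℝ) := by
  rw [h.inner_phi_left, h.phi_xi, inner_zero_left, neg_zero]

theorem mdifferentiable_xi : MDiffAt (T% ξ) x :=
  (h.smooth_xi x).mdifferentiableAt (by simp)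

theorem mdifferentiableAt_phi (hY : MDiffAt (T% Y) x) : MDiffAt (T% (fun y ↦ φ y (Y y))) x :=
  MDifferentiableAt.clm_bundle_apply (F₁ := E) (F₂ := E) (E₁ := fun x : M ↦ TangentSpace I x)
    (E₂ := fun x : M ↦ TangentSpace I x) ((h.smooth_phi x).mdifferentiableAt (by simp)) hY

theorem inner_leviCivita_xi (x : M) (v : TangentSpace I x) :
    inner ℝ (leviCivita I M ξ x v) (ξ x) = (0 : ℝ) := by
  have h1 := mvfderiv_metricFun_apply h.mdifferentiable_xi h.mdifferentiable_xi v
  have h2 : metricFun ξ ξ = fun _ ↦ (1 : ℝ) := by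
    ext y
    exact h.inner_xi_xi y
  rw [h2, mvfderiv_const, real_inner_comm (leviCivita I M ξ x v) (ξ x), zero_apply] at h1
  linarith

end IsAlmostContactMetric

namespace IsTransSasakian

variable {α β : ℝ} (h : IsTransSasakian φ ξ η (fun _ ↦ α) (fun _ ↦ β))
include h

/-- Since `φξ = 0`, `(∇_v φ)ξ = -φ(∇_v ξ)`. As `ξ` has unit length, `∇_v ξ` is orthogonal to `ξ`,
where `φ² = -I`; applying `φ` therefore recovers it. -/
theorem leviCivita_xi (x : M) (v : TangentSpace I x) :
    leviCivita I M ξ x v = -(α • φ x v) + β • (v - η x v • ξ x) := by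
  have h1 := h.cov_phi x v ξ h.mdifferentiable_xi
  have h2 : (fun y ↦ φ y (ξ y)) = 0 := by
    ext1 y
    exact h.phi_xi y
  rw [covDerivEnd, h2, (leviCivita I M).isCovariantDerivativeOn.zero] at h1
  have h3 := congrArg (φ x) h1
  have h4 := h.phi_sq x (leviCivita I M ξ x v)
  rw [h.eta_eq x (leviCivita I M ξ x v), h.inner_leviCivita_xi, zero_smul, add_zero] at h4
  simp only [zero_apply, zero_sub, map_neg, map_add, map_sub, map_smul, h4, h.eta_xi, h.phi_xi,
    h.phi_sq, h.inner_phi_xi] at h3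
  rw [neg_neg] at h3
  rw [h3]
  module

theorem leviCivita_leviCivita_xi (hY : MDiffAt (T% Y) x) (v : TangentSpace I x) :
    leviCivita I M (fun y ↦ leviCivita I M ξ y (Y y)) x v =
      -(α • (covDerivEnd φ Y x v + φ x (leviCivita I M Y x v)))
        + β • (leviCivita I M Y x v - inner ℝ (Y x) (ξ x) • leviCivita I M ξ x v
          - (inner ℝ (leviCivita I M Y x v) (ξ x) + inner ℝ (Y x) (leviCivita I M ξ x v)) • ξ x) := by
  have hξ : MDiffAt (T% ξ) x := h.mdifferentiable_xi
  have hφY := h.mdifferentiableAt_phi hY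
  have hg := mdiff_metricFun hY hξ
  have hgξ := hg.smul_section hξ
  have hcov := (leviCivita I M).isCovariantDerivativeOnUniv
  -- Writing `η(Y)` as the function `g(Y,ξ)` exposes the field to the Leibniz rule and to metric
  -- compatibility.
  have hU : (fun y ↦ leviCivita I M ξ y (Y y)) =
      (-α) • (fun y ↦ φ y (Y y)) + (β • Y + (-β) • (metricFun Y ξ • ξ)) := by
    ext1 y
    simp only [h.leviCivita_xi, h.eta_eq, Pi.add_apply, Pi.smul_apply, Pi.smul_apply', metricFun]
    module
  rw [hU, hcov.add (.smul_const_section hφY)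
      (mdifferentiableAt_add_section (.smul_const_section hY) (.smul_const_section hgξ)),
    hcov.add (.smul_const_section hY) (.smul_const_section hgξ), hcov.smul_const _ hφY,
    hcov.smul_const _ hY, hcov.smul_const _ hgξ, hcov.leibniz hξ hg]
  simp only [add_apply, smul_apply, ContinuousLinearMap.smulRight_apply,
    mvfderiv_metricFun_apply hY hξ, covDerivEnd, metricFun]
  module

/-- Torsion-freeness turns the bracket into `∇_X Y - ∇_Y X`, which cancels every term containing
derivatives of `X` or `Y`; only `∇φ` and `∇ξ` remain, and both are known. -/
theorem curvature_xi (hX : MDiffAt (T% X) x) (hY : MDiffAt (T% Y) x) :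
    curvature X Y ξ x = (α ^ 2 - β ^ 2) • (η x (Y x) • X x - η x (X x) • Y x)
      + (2 * (α * β)) • (η x (Y x) • φ x (X x) - η x (X x) • φ x (Y x)) := by
  rw [curvature, h.leviCivita_leviCivita_xi hX, h.leviCivita_leviCivita_xi hY,
    mlieBracket_eq_leviCivita_sub hX hY, map_sub, h.cov_phi x _ X hX, h.cov_phi x _ Y hY]
  simp only [h.leviCivita_xi, inner_add_right, inner_sub_right, inner_neg_right,
    inner_smul_right]
  rw [real_inner_comm (φ x (X x)) (Y x), real_inner_comm (φ x (Y x)) (X x),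
    h.inner_phi_left x (Y x) (X x), real_inner_comm (X x) (Y x)]
  simp only [h.eta_eq]
  module

theorem ricci_xi [T2Space M] (hdim : Module.finrank ℝ E = 3) (x : M) (v : TangentSpace I x) :
    ricci x v (ξ x) = 2 * (α ^ 2 - β ^ 2) * η x v := by
  have hterm : ∀ u : TangentSpace I x,
      inner ℝ (curvature (I := I) (FiberBundle.extend E u) (FiberBundle.extend E v)
        (FiberBundle.extend E (ξ x)) x) u =
      (α ^ 2 - β ^ 2) * (η x v * inner ℝ u u - inner ℝ (ξ x) u * inner ℝ v u)
        - 2 * (α * β) * (inner ℝ (ξ x) u * inner ℝ (φ x v) u) := fun u ↦ by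
    -- `ricci` uses an arbitrary extension of `ξ x`, while `curvature_xi` concerns the field `ξ`.
    -- Skew-symmetry moves the third argument into the inner product, where only its value at `x`
    -- counts; applying it twice exchanges the two fields.
    have hu := contMDiffAt_extend u
    have hv := contMDiffAt_extend v
    have h1 := inner_curvature_swap hu hv (contMDiffAt_extend (ξ x)) hu
    have h2 := inner_curvature_swap hu hv (h.smooth_xi x) hu
    simp only [FiberBundle.extend_apply_self] at h1 h2
    rw [h1, ← h2, h.curvature_xi (hu.mdifferentiableAt (by simp)) (hv.mdifferentiableAt (by simp))]
    simp only [FiberBundle.extend_apply_self, inner_add_left, inner_sub_left, inner_smul_left,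
      h.inner_phi_self, h.eta_eq x u, real_inner_comm u (ξ x)]
    simp
    ring
  -- The trace contributes `3 η(v) - η(v)`, and the `αβ` part reduces to a multiple of `g(ξ, φv) =
  -- 0`.
  simp only [ricci, hterm, Finset.sum_sub_distrib, ← Finset.mul_sum, sum_inner_frame_mul,
    sum_inner_frame_self hdim]
  rw [real_inner_comm, ← h.eta_eq, real_inner_comm, h.inner_phi_xi]
  ring

end IsTransSasakian

end TransSasakian

/-! ### The soliton equation and constancy of `b`. -/

section Soliton

set_option linter.unusedSectionVars false

/-- Without boundary the chart target is open, so it contains a ball on which the mean value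
inequality applies; this gives local constancy, and connectedness does the rest. -/
theorem eq_const_of_mvfderiv_eq_zero {E : Type*} [NormedAddCommGroup E] [NormedSpace ℝ E]
    {H : Type*} [TopologicalSpace H] {I : ModelWithCorners ℝ E H} [I.Boundaryless]
    {M : Type*} [TopologicalSpace M] [ChartedSpace H M] [IsManifold I 1 M] [PreconnectedSpace M]
    {f : M → ℝ} (hf : MDiff f) (hdf : ∀ x, d% f x = 0) (x y : M) : f x = f y := by
  refine IsLocallyConstant.apply_eq_of_preconnectedSpace ?_ x y
  rw [IsLocallyConstant.iff_eventually_eq]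
  intro x
  obtain ⟨r, hr, hball⟩ := Metric.isOpen_iff.1 (isOpen_extChartAt_target (I := I) x) _
    (mem_extChartAt_target x)
  have hd : ∀ z ∈ Metric.ball (extChartAt I x x) r,
      HasFDerivAt (f ∘ (extChartAt I x).symm) (0 : E →L[ℝ] ℝ) z := fun z hz ↦ by
    have h1 := (hf ((extChartAt I x).symm z)).hasMFDerivAt.comp_hasMFDerivWithinAt z
      (mdifferentiableWithinAt_extChartAt_symm (hball hz)).hasMFDerivWithinAt
    rw [I.range_eq_univ, hasMFDerivWithinAt_univ] at h1
    have h2 : mfderiv% f ((extChartAt I x).symm z) = 0 := by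
      ext v
      exact congrArg (fun A ↦ A v) (hdf ((extChartAt I x).symm z))
    rw [h2, ContinuousLinearMap.zero_comp] at h1
    exact h1.hasFDerivAt
  have hnhds : (extChartAt I x) ⁻¹' Metric.ball (extChartAt I x x) r ∈ 𝓝 x :=
    (continuousAt_extChartAt x).preimage_mem_nhds (Metric.ball_mem_nhds _ hr)
  filter_upwards [hnhds, extChartAt_source_mem_nhds (I := I) x] with y hy hys
  have h := (convex_ball (extChartAt I x x) r).is_const_of_fderivWithin_eq_zero (𝕜 := ℝ)
    (f := f ∘ (extChartAt I x).symm) (fun z hz ↦ (hd z hz).differentiableAt.differentiableWithinAt)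
    (fun z hz ↦ by
      rw [fderivWithin_of_isOpen Metric.isOpen_ball hz]
      exact (hd z hz).fderiv) hy (Metric.mem_ball_self hr)
  rwa [Function.comp_apply, Function.comp_apply, (extChartAt I x).left_inv hys,
    extChartAt_to_inv] at h

variable {E : Type*} [NormedAddCommGroup E] [NormedSpace ℝ E] [FiniteDimensional ℝ E]
  {H : Type*} [TopologicalSpace H] {I : ModelWithCorners ℝ E H}
  {M : Type*} [TopologicalSpace M] [ChartedSpace H M] [IsManifold I ∞ M]
  [RiemannianBundle (fun x : M ↦ TangentSpace I x)]
  [IsContMDiffRiemannianBundle I ∞ E (fun x : M ↦ TangentSpace I x)]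
  {φ : Π x : M, TangentSpace I x →L[ℝ] TangentSpace I x}
  {ξ V : Π x : M, TangentSpace I x} {η : Π x : M, TangentSpace I x →L[ℝ] ℝ}
  {X Y : Π x : M, TangentSpace I x} {b : M → ℝ} {x : M} {α β lam mu : ℝ}

/-- Metric compatibility and vanishing torsion cancel the derivatives of `X` and `Y` along `V`. -/
theorem lieDerivMetric_eq (hV : MDiffAt (T% V) x) (hX : MDiffAt (T% X) x)
    (hY : MDiffAt (T% Y) x) :
    lieDerivMetric V X Y x = inner ℝ (leviCivita I M V x (X x)) (Y x)
      + inner ℝ (X x) (leviCivita I M V x (Y x)) := by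
  rw [lieDerivMetric, mvfderiv_metricFun_apply hX hY, mlieBracket_eq_leviCivita_sub hV hX,
    mlieBracket_eq_leviCivita_sub hV hY, inner_sub_left, inner_sub_right]
  ring

theorem IsAlmostContactMetric.exists_orthogonal_xi (h : IsAlmostContactMetric φ ξ η)
    (hdim : Module.finrank ℝ E = 3) (x : M) :
    ∃ v : TangentSpace I x, v ≠ 0 ∧ inner ℝ v (ξ x) = (0 : ℝ) := by
  have hξ : ξ x ≠ 0 := fun h0 ↦ by
    have h1 := h.inner_xi_xi x
    rw [h0, inner_zero_left] at h1
    exact zero_ne_one h1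
  have hne : (ℝ ∙ ξ x)ᗮ ≠ ⊥ := fun hbot ↦ by
    have h1 := finrank_span_singleton (K := ℝ) hξ
    rw [(Submodule.orthogonal_eq_bot_iff).1 hbot, finrank_top] at h1
    have h2 : Module.finrank ℝ (TangentSpace I x) = 3 := hdim
    omega
  obtain ⟨v, hv, hv0⟩ := Submodule.exists_mem_ne_zero_of_ne_bot hne
  exact ⟨v, hv0, (Submodule.mem_orthogonal_singleton_iff_inner_left).1 hv⟩

/-- If `db = f η` on a trans-Sasakian `3`-manifold of type `(α, β)` with `α ≠ 0`, then `f = 0`,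
since `η` is a contact form. -/
theorem IsTransSasakian.mvfderiv_xi_eq_zero (h : IsTransSasakian φ ξ η (fun _ ↦ α) (fun _ ↦ β))
    (hdim : Module.finrank ℝ E = 3) (hα : α ≠ 0) (hb : CMDiff ∞ b)
    (hdb : ∀ (x : M) (v : TangentSpace I x), d% b x v = d% b x (ξ x) * η x v) (x : M) :
    d% b x (ξ x) = 0 := by
  obtain ⟨v, hv, hvξ⟩ := h.exists_orthogonal_xi hdim x
  have hξ : MDiffAt (T% ξ) x := h.mdifferentiable_xi
  -- Here `db(X) = db(ξ) g(X,ξ)`. Where `g(X,ξ)` vanishes, the derivative of the factor `db(ξ)`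
  -- disappears by the product rule.
  have hd : ∀ (X : Π x : M, TangentSpace I x), MDiffAt (T% X) x → ∀ (w : TangentSpace I x),
      inner ℝ (X x) (ξ x) = (0 : ℝ) → d% (fun y ↦ d% b y (X y)) x w =
      d% b x (ξ x) * (inner ℝ (leviCivita I M X x w) (ξ x)
        + inner ℝ (X x) (leviCivita I M ξ x w)) := fun X hX w hXξ ↦ by
    have heq : (fun y ↦ d% b y (X y)) = (fun y ↦ d% b y (ξ y)) * metricFun X ξ := by
      ext y
      rw [hdb, h.eta_eq]
      rfl
    rw [heq, mvfderiv_mul ((contMDiffAt_mvfderiv_apply (hb x) (h.smooth_xi x)).mdifferentiableAt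
      (by simp)) (mdiff_metricFun hX hξ), add_apply, smul_apply, smul_apply,
      mvfderiv_metricFun_apply hX hξ]
    simp [metricFun, hXξ]
  have hX := contMDiffAt_extend v
  have hY := contMDiffAt_extend (φ x v)
  have hX' := hX.mdifferentiableAt (by simp)
  have hY' := hY.mdifferentiableAt (by simp)
  have hcomm := mvfderiv_mlieBracket (hb x) hX hY
  rw [hd _ hX' _ (by simpa using hvξ), hd _ hY' _ (by simpa using h.inner_phi_xi x v), hdb,
    h.eta_eq, mlieBracket_eq_leviCivita_sub hX' hY', inner_sub_left] at hcomm
  simp only [FiberBundle.extend_apply_self, h.leviCivita_xi, h.phi_sq, h.eta_eq, hvξ,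
    h.inner_phi_xi, inner_add_right, inner_neg_right, inner_smul_right, h.inner_phi_phi,
    h.inner_phi_self, zero_smul, sub_zero, add_zero, real_inner_comm (φ x v) v] at hcomm
  have hvv : (inner ℝ v v : ℝ) ≠ 0 := inner_self_ne_zero.2 hv
  -- With `X`, `Y` extending `v`, `φv`, the terms in `∇X` and `∇Y` match those of the bracket. What
  -- remains is `g(φv, ∇_v ξ) - g(v, ∇_{φv} ξ) = -2α g(v,v)`, times `db(ξ)`.
  have hz : d% b x (ξ x) * (2 * α * inner ℝ v v) = 0 := by linarith
  exact (mul_eq_zero.1 hz).resolve_right (by positivity)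

/-- The soliton equation for a potential field `b ξ` on a trans-Sasakian manifold. -/
theorem IsEtaEinsteinSoliton.ricci_eq (h : IsTransSasakian φ ξ η (fun _ ↦ α) (fun _ ↦ β))
    (hV : IsEtaEinsteinSoliton η V lam mu) (hb : CMDiff ∞ b) (hVb : ∀ x, V x = b x • ξ x)
    (x : M) (v w : TangentSpace I x) :
    d% b x v * η x w + d% b x w * η x v + 2 * (b x * β) * (inner ℝ v w - η x v * η x w)
      + 2 * ricci x v w + (2 * lam - scalarCurvature I M x) * inner ℝ v w
      + 2 * mu * (η x v * η x w) = 0 := by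
  have hX := mdifferentiableAt_extend v
  have hY := mdifferentiableAt_extend w
  have h1 := hV.eq_zero x _ _ hX hY
  have hξ : MDiffAt (T% ξ) x := h.mdifferentiable_xi
  have hbx : MDiffAt b x := (hb x).mdifferentiableAt (by simp)
  rw [lieDerivMetric_eq ((hV.smooth x).mdifferentiableAt (by simp)) hX hY, funext hVb] at h1
  have h2 : leviCivita I M (fun y ↦ b y • ξ y) x = _ :=
    (leviCivita I M).isCovariantDerivativeOn.leibniz hξ hbx
  rw [h2] at h1
  simp only [FiberBundle.extend_apply_self, add_apply, smul_apply,
    ContinuousLinearMap.smulRight_apply, h.leviCivita_xi, inner_add_left, inner_add_right,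
    inner_sub_left, inner_sub_right, inner_neg_left, inner_neg_right, real_inner_smul_left,
    real_inner_smul_right, h.eta_eq] at h1 ⊢
  rw [h.inner_phi_left x v w, real_inner_comm (φ x w) v, real_inner_comm w (ξ x)] at h1
  linear_combination h1

theorem IsEtaEinsteinSoliton.const_and_etaEinstein [T2Space M] [PreconnectedSpace M]
    [I.Boundaryless] (hdim : Module.finrank ℝ E = 3) (hαβ : α ≠ 0 ∨ β ≠ 0)
    (h : IsTransSasakian φ ξ η (fun _ ↦ α) (fun _ ↦ β))
    (hV : IsEtaEinsteinSoliton η V lam mu) (hVb : ∀ x, V x = b x • ξ x) :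
    (∃ c : ℝ, ∀ x : M, b x = c) ∧ IsEtaEinstein η ∧
      ∀ x : M, scalarCurvature I M x = 2 * lam + 2 * mu + 4 * (α ^ 2 - β ^ 2) := by
  have hb : CMDiff ∞ b := by
    -- `b` is given only as a function; its smoothness is inherited from `V` and `ξ`.
    have heq : b = metricFun V ξ := by
      ext x
      rw [metricFun, hVb, real_inner_smul_left, h.inner_xi_xi, mul_one]
    rw [heq]
    exact fun x ↦ contMDiffAt_metricFun (hV.smooth x) (h.smooth_xi x)
  have hsol := hV.ricci_eq h hb hVb
  have hxi : ∀ (x : M), 2 * d% b x (ξ x) + 4 * (α ^ 2 - β ^ 2) + 2 * lam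
      - scalarCurvature I M x + 2 * mu = 0 := fun x ↦ by
    have h1 := hsol x (ξ x) (ξ x)
    rw [h.ricci_xi hdim, h.inner_xi_xi, h.eta_xi] at h1
    linarith
  have hdb : ∀ (x : M) (v : TangentSpace I x), d% b x v = d% b x (ξ x) * η x v := fun x v ↦ by
    have h1 := hsol x v (ξ x)
    rw [h.ricci_xi hdim, ← h.eta_eq, h.eta_xi] at h1
    linear_combination h1 - η x v * hxi x
  -- In dimension 3 the trace reads `2 db(ξ) + 4bβ + 2r + 3(2λ - r) + 2μ = 0`; subtracting `hxi`
  -- eliminates both `db(ξ)` and `r`.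
  have htrace : ∀ x : M, b x * β = α ^ 2 - β ^ 2 - lam := fun x ↦ by
    have h1 := Finset.sum_congr rfl fun i (_ : i ∈ Finset.univ) ↦
      hsol x (frame I M x i) (frame I M x i)
    have hη : ∑ i, η x (frame I M x i) * η x (frame I M x i) = 1 := by
      simp only [h.eta_eq, real_inner_comm (ξ x)]
      rw [sum_inner_frame_mul, h.inner_xi_xi]
    have hr : ∑ i, ricci x (frame I M x i) (frame I M x i) = scalarCurvature I M x := rfl
    simp only [hdb x (frame I M x _), mul_assoc, Finset.sum_add_distrib, ← Finset.mul_sum,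
      Finset.sum_sub_distrib, hη, hr, sum_inner_frame_self hdim, Finset.sum_const_zero] at h1
    push_cast at h1
    linarith [hxi x]
  have hconst : ∀ x y : M, b x = b y := by
    rcases hαβ with hα | hβ
    · have : IsManifold I 1 M := IsManifold.of_le (n := ∞) (by simp)
      refine eq_const_of_mvfderiv_eq_zero (I := I) (hb.mdifferentiable (by simp)) fun x ↦ ?_
      ext v
      rw [hdb, h.mvfderiv_xi_eq_zero hdim hα hb hdb, zero_mul, zero_apply]
    · exact fun x y ↦ mul_right_cancel₀ hβ ((htrace x).trans (htrace y).symm)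
  have hdb0 : ∀ x : M, d% b x = 0 := fun x ↦ by
    rw [show b = fun _ ↦ b x from funext fun y ↦ hconst y x, mvfderiv_const]
  have hscal : ∀ x : M, scalarCurvature I M x = 2 * lam + 2 * mu + 4 * (α ^ 2 - β ^ 2) := by
    intro x
    have h1 := hxi x
    rw [hdb0, zero_apply] at h1
    linarith
  -- These coefficients come from solving the soliton equation for `S` after substituting `db = 0`,
  -- `htrace` and `hscal`.
  refine ⟨?_, ⟨fun _ ↦ mu + lam + (α ^ 2 - β ^ 2), fun _ ↦ α ^ 2 - β ^ 2 - lam - mu,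
    contMDiff_const, contMDiff_const, fun x v w ↦ ?_⟩, hscal⟩
  -- Preconnectedness allows `M` to be empty, so a base point need not exist.
  · by_cases hne : Nonempty M
    · exact ⟨b hne.some, fun x ↦ hconst x _⟩
    · exact ⟨0, fun x ↦ (hne ⟨x⟩).elim⟩
  · have h1 := hsol x v w
    rw [hdb0, zero_apply, zero_apply, htrace, hscal] at h1
    linear_combination h1 / 2

end Soliton

end RiemGeom

end

theorem theorem3p2 {M : Type*} [TopologicalSpace M] [T2Space M] [SecondCountableTopology M]
    [ConnectedSpace M] [ChartedSpace (EuclideanSpace ℝ (Fin 3)) M] [IsManifold (𝓡 3) ∞ M]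
    [RiemannianBundle (fun x : M ↦ TangentSpace (𝓡 3) x)]
    [IsContMDiffRiemannianBundle (𝓡 3) ∞ (EuclideanSpace ℝ (Fin 3))
      (fun x : M ↦ TangentSpace (𝓡 3) x)]
    (φ : Π x : M, TangentSpace (𝓡 3) x →L[ℝ] TangentSpace (𝓡 3) x)
    (ξ : Π x : M, TangentSpace (𝓡 3) x) (η : Π x : M, TangentSpace (𝓡 3) x →L[ℝ] ℝ)
    (α β : ℝ) (hαβ : α ≠ 0 ∨ β ≠ 0)
    (hM : RiemGeom.IsTransSasakian φ ξ η (fun _ ↦ α) (fun _ ↦ β))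
    (V : Π x : M, TangentSpace (𝓡 3) x) (lam mu : ℝ)
    (hV : RiemGeom.IsEtaEinsteinSoliton η V lam mu)
    (b : M → ℝ) (hb : ∀ x : M, V x = b x • ξ x) :
    (∃ c : ℝ, ∀ x : M, b x = c) ∧ RiemGeom.IsEtaEinstein η ∧
      ∀ x : M, RiemGeom.scalarCurvature (𝓡 3) M x =
        2 * lam + 2 * mu + 4 * (α ^ 2 - β ^ 2) :=
  hV.const_and_etaEinstein finrank_euclideanSpace_fin hαβ hM hb
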